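/- Let $D,H,N\ge 1$ be integers with $H\mid D$, and let $W^{Q,h},W^{V,h}\in\mathbb R^{D\times D/H}$ ($h=1,\dots,H$) and $W^O\in\mathbb R^{D\times D}$. For $X\in\mathbb R^{N\times D}$ with rows $\mathbf x_1^\top,\dots,\mathbf x_N^\top$ let $P^h=P^h(X)\in\mathbb R^{N\times N}$ be given by $$P^h_{ij}=\frac{\exp(L^h_{ij})}{\sum_k\exp(L^h_{ik})},\qquad L^h_{ij}=-\frac{\|\mathbf x_i^\top W^{Q,h}-\mathbf x_j^\top W^{Q,h}\|_2^2}{\sqrt{D/H}},$$ and let $f^h(X)=P^hXA_h$ with $A_h=W^{Q,h}W^{Q,h\top}/\sqrt{D/H}$. L2 multihead self-attention with tied query and key weights is the map $$F:\mathbb R^{N\times D}\to\mathbb R^{N\times D},\qquad F(X)=\left[f^1(X)W^{V,1},\dots,f^H(X)W^{V,H}\right]W^O .$$ For $p\in\{2,\infty\}$, $\mathrm{Lip}_p(F)$ is the smallest $K\ge0$ such that $F$ is $K$-Lipschitz for the vector $p$-norm on $\mathbb R^{N\times D}\cong\mathbb R^{ND}$, and $\|W\|_p=\sup_{\|\mathbf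 x\|_p=1}\|W\mathbf x\|_p$ for a matrix $W$. Let $\phi(x)=x\,e^{x+1}$. **Theorem.** The function $\phi$ is a bijection of $[0,\infty)$ onto itself; write $\phi^{-1}$ for its inverse. The map $F$ is Lipschitz for both norms, with $$\mathrm{Lip}_\infty(F)\le\left(4\phi^{-1}(N-1)+\frac1{\sqrt{D/H}}\right)\|W^{O\top}\|_\infty\ \max_h\left(\|W^{Q,h}\|_\infty\|W^{Q,h\top}\|_\infty\right)\ \max_h\|W^{V,h\top}\|_\infty,$$ $$\mathrm{Lip}_2(F)\le\frac{\sqrt N}{\sqrt{D/H}}\left(4\phi^{-1}(N-1)+1\right)\sqrt{\sum_h\|W^{Q,h}\|_2^4\,\|W^{V,h}\|_2^2}\ \|W^O\|_2 .$$ For all $X$, $h$ and $i$, the covariance matrix of the distribution on $\mathbb R^{D/H}$ that puts mass $P^h_{ij}(X)$ on the $j$-th row of $XW^{Q,h}/(D/H)^{1/4}$ ($j=1,\dots,N$) has trace at most $\phi^{-1}(N-1)$. Moreover $\phi^{-1}(N-1)=W_0\!\left(\frac{N-1}{e}\right)$, where $W_0$ is the principal branch of the Lambert function (the inverse of $w\mapsto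 we^w$ on $[-1,\infty)$), and $\phi^{-1}(N-1)=O(\log N-\log\log N)$ as $N\to\infty$. Hence, for fixed $D$, $H$ and fixed weight matrices, the two bounds above are $O(\log N)$ and $O(\sqrt N\log N)$, respectively, as $N\to\infty$. -/

import Mathlib

open scoped ENNReal NNReal

namespace L2Attention

noncomputable section

/-- The Lipschitz constant of `f`: the smallest `K ≥ 0` such that `f` is `K`-Lipschitz
(a meaningful value as soon as some such `K` exists). -/
def lipConst {α β : Type*} [PseudoMetricSpace α] [PseudoMetricSpace β] (f : α → β) : ℝ≥0 :=
  sInf {K : ℝ≥0 | LipschitzWith K f}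

/-- The operator norm `‖W‖_p = sup_{‖x‖_p = 1} ‖W x‖_p` of a real matrix acting on column
vectors, induced by the vector `p`-norms. -/
def opNorm (p : ℝ≥0∞) [Fact (1 ≤ p)] {m n : ℕ} (W : Matrix (Fin m) (Fin n) ℝ) : ℝ :=
  ‖LinearMap.toContinuousLinearMap (Matrix.toLpLin p p W)‖

/-- A map between `N × D` matrices, viewed as a map of `ℝ^{N D}` with the (entrywise) vector
`p`-norm. -/
def flatten (p : ℝ≥0∞) {N D : ℕ}
    (F : Matrix (Fin N) (Fin D) ℝ → Matrix (Fin N) (Fin D) ℝ) :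
    PiLp p (fun _ : Fin N × Fin D => ℝ) → PiLp p (fun _ : Fin N × Fin D => ℝ) :=
  fun x => WithLp.toLp p fun ij => F (Matrix.of fun i j => x (i, j)) ij.1 ij.2

/-- `φ(x) = x exp(x + 1)`. -/
def phi (x : ℝ) : ℝ := x * Real.exp (x + 1)

/-- The inverse of `φ` on `[0, ∞)`. -/
def phiInv : ℝ → ℝ := Function.invFunOn phi (Set.Ici 0)

/-- The principal branch `W₀` of the Lambert function: the inverse of `w ↦ w exp w` on
`[-1, ∞)`. -/
def lambertW0 : ℝ → ℝ := Function.invFunOn (fun w : ℝ => w * Real.exp w) (Set.Ici (-1))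

/-- Rowwise softmax of a square matrix of logits. -/
def softmax {N : ℕ} (L : Matrix (Fin N) (Fin N) ℝ) : Matrix (Fin N) (Fin N) ℝ :=
  Matrix.of fun i j => Real.exp (L i j) / ∑ k, Real.exp (L i k)

/-- The logits `L i j = - ‖x_iᵀ W^Q - x_jᵀ W^K‖₂² / √(D/H)`. -/
def logits {N D : ℕ} (H : ℕ) (WQ WK : Matrix (Fin D) (Fin (D / H)) ℝ)
    (X : Matrix (Fin N) (Fin D) ℝ) : Matrix (Fin N) (Fin N) ℝ :=
  Matrix.of fun i j =>
    -(‖WithLp.toLp 2 (Matrix.vecMul (X i) WQ - Matrix.vecMul (X j) WK)‖ ^ 2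
      / Real.sqrt ((D : ℝ) / H))

/-- The attention matrix `P` of an L2 self-attention head. -/
def attn {N D : ℕ} (H : ℕ) (WQ WK : Matrix (Fin D) (Fin (D / H)) ℝ)
    (X : Matrix (Fin N) (Fin D) ℝ) : Matrix (Fin N) (Fin N) ℝ :=
  softmax (logits H WQ WK X)

/-- The head `f(X) = P X A` with tied weights `W^K = W^Q` and `A = W^Q (W^Q)ᵀ / √(D/H)`. -/
def head {N D : ℕ} (H : ℕ) (WQ : Matrix (Fin D) (Fin (D / H)) ℝ)
    (X : Matrix (Fin N) (Fin D) ℝ) : Matrix (Fin N) (Fin D) ℝ :=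
  attn H WQ WQ X * X * ((Real.sqrt ((D : ℝ) / H))⁻¹ • (WQ * WQ.transpose))

/-- The `D` columns of a concatenation of `H` blocks of `D / H` columns: a column index is a
block number together with an index inside this block, ordered block by block. -/
def colEquiv {D H : ℕ} (hHD : H ∣ D) : Fin D ≃ Fin H × Fin (D / H) :=
  (finCongr (Nat.mul_div_cancel' hHD).symm).trans finProdFinEquiv.symm

/-- The horizontal concatenation `[M^1, …, M^H]`. -/
def concat {N D H : ℕ} (hHD : H ∣ D) (M : Fin H → Matrix (Fin N) (Fin (D / H)) ℝ) :
    Matrix (Fin N) (Fin D) ℝ :=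
  Matrix.of fun i c => M (colEquiv hHD c).1 i (colEquiv hHD c).2

/-- L2 multihead self-attention
`F(X) = [f^1(X) W^{V,1}, …, f^H(X) W^{V,H}] W^O` with tied query and key weights. -/
def mha {D H : ℕ} (hHD : H ∣ D) (WQ WV : Fin H → Matrix (Fin D) (Fin (D / H)) ℝ)
    (WO : Matrix (Fin D) (Fin D) ℝ) (N : ℕ) (X : Matrix (Fin N) (Fin D) ℝ) :
    Matrix (Fin N) (Fin D) ℝ :=
  concat hHD (fun h => head H (WQ h) X * WV h) * WO

/-- The covariance matrix of the distribution on `ℝ^d` which puts mass `p j` on the `j`-th row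
of `Y`. -/
def cov {N d : ℕ} (p : Fin N → ℝ) (Y : Matrix (Fin N) (Fin d) ℝ) :
    Matrix (Fin d) (Fin d) ℝ :=
  Matrix.of fun a b =>
    ∑ j, p j * ((Y j a - ∑ k, p k * Y k a) * (Y j b - ∑ k, p k * Y k b))

/-- The bound for `p = ∞` at sequence length `N` (the suprema are maxima over the heads). -/
def boundTop {D H : ℕ} (WQ WV : Fin H → Matrix (Fin D) (Fin (D / H)) ℝ)
    (WO : Matrix (Fin D) (Fin D) ℝ) (N : ℕ) : ℝ :=
  (4 * phiInv ((N : ℝ) - 1) + 1 / Real.sqrt ((D : ℝ) / H)) * opNorm ∞ WO.transpose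
    * (⨆ h, opNorm ∞ (WQ h) * opNorm ∞ (WQ h).transpose)
    * (⨆ h, opNorm ∞ (WV h).transpose)

/-- The bound for `p = 2` at sequence length `N`. -/
def boundTwo {D H : ℕ} (WQ WV : Fin H → Matrix (Fin D) (Fin (D / H)) ℝ)
    (WO : Matrix (Fin D) (Fin D) ℝ) (N : ℕ) : ℝ :=
  Real.sqrt N / Real.sqrt ((D : ℝ) / H) * (4 * phiInv ((N : ℝ) - 1) + 1)
    * Real.sqrt (∑ h, opNorm 2 (WQ h) ^ 4 * opNorm 2 (WV h) ^ 2) * opNorm 2 WO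

end

end L2Attention

/-!
The rows `x_j` enter a head only through the points `y_j = Wᵀ x_j`: with `s = √(D/H)`, row `i` of
the head is `W m_i / s`, where `m_i` is the mean of the `y_j` under the softmax weights `P_ij` of
the energies `a_j = ‖y_i - y_j‖² / s` (`head_row`).

*Mean energy.* As `a_i = 0`, the mean energy `T = ∑ P_ij a_j` satisfies
`T = ∑_{j ≠ i} (a_j - T) exp (-a_j) ≤ (N - 1) exp (-T - 1)`, since `x exp (-x) ≤ exp (-1)`. Hence
`T ≤ φ⁻¹ (N - 1)` (`sum_gibbs_mul_le_phiInv`). The mean minimizes the weighted squared distance, so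
`s T` also bounds `∑ P_ij ‖y_j - m_i‖²`, which is the claim about the covariance (`trace_cov_le`).

*Lipschitz bounds.* Along a line with direction `u`, the derivative of `⟪w, m_i⟫` is
`∑ P_ij ⟪w, u_j⟫ - (2 / s) ∑ P_ij ⟪w, y_j - m_i⟫ ⟪y_i - y_j, u_i - u_j⟫`. The last sum is at most
`‖w‖ max ‖u_i - u_j‖ ∑ P_ij ‖y_j - m_i‖ ‖y_i - y_j‖`, and by the two bounds above the sum left is at
most `s φ⁻¹ (N - 1)`. The mean value inequality then bounds the increments of `m_i`
(`abs_inner_attnMean_sub_le`), and the operator norms of the weight matrices carry this bound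
through the heads and the output projection (`lipschitzWith_flatten_top`,
`lipschitzWith_flatten_two`).

*Growth.* With `L = log N`, one has `φ (L - log L) = e (L - log L) N / L ≥ N`, so
`φ⁻¹ (N - 1) ≤ L - log L` (`phiInv_le_log_sub_log_log`).
-/

open scoped ENNReal NNReal

namespace L2Attention

/-! ### The function `φ` and its inverse -/

theorem strictMonoOn_mul_exp : StrictMonoOn (fun w : ℝ => w * Real.exp w) (Set.Ici (-1)) := by
  refine strictMonoOn_of_deriv_pos (convex_Ici _) (by fun_prop) fun x hx => ?_
  rw [interior_Ici, Set.mem_Ioi] at hx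
  have h : HasDerivAt (fun w : ℝ => w * Real.exp w) (1 * Real.exp x + x * Real.exp x) x :=
    (hasDerivAt_id x).mul (Real.hasDerivAt_exp x)
  rw [h.deriv, ← add_mul]
  exact mul_pos (by linarith) (Real.exp_pos x)

theorem phi_eq (x : ℝ) : phi x = Real.exp 1 * (x * Real.exp x) := by
  rw [phi, Real.exp_add]; ring

theorem strictMonoOn_phi : StrictMonoOn phi (Set.Ici 0) := by
  intro x hx y hy hxy
  rw [phi_eq, phi_eq]
  rw [Set.mem_Ici] at hx hy
  exact mul_lt_mul_of_pos_left
    (strictMonoOn_mul_exp (by simp; linarith) (by simp; linarith) hxy) (Real.exp_pos 1)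

theorem bijOn_phi : Set.BijOn phi (Set.Ici 0) (Set.Ici 0) := by
  refine ⟨fun x hx => mul_nonneg hx (Real.exp_pos _).le, strictMonoOn_phi.injOn, fun y hy => ?_⟩
  rw [Set.mem_Ici] at hy
  have hc : ContinuousOn phi (Set.Icc 0 y) := by unfold phi; fun_prop
  have h0 : phi 0 ≤ y := by simpa [phi] using hy
  have h1 : y ≤ phi y :=
    le_mul_of_one_le_right hy (Real.one_le_exp (by linarith))
  obtain ⟨x, hx, rfl⟩ := intermediate_value_Icc hy hc ⟨h0, h1⟩
  exact ⟨x, hx.1, rfl⟩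

theorem phiInv_nonneg {y : ℝ} (hy : 0 ≤ y) : 0 ≤ phiInv y :=
  Function.invFunOn_mem (bijOn_phi.surjOn hy)

theorem phi_phiInv {y : ℝ} (hy : 0 ≤ y) : phi (phiInv y) = y :=
  Function.invFunOn_eq (bijOn_phi.surjOn hy)

theorem le_phiInv {x y : ℝ} (hx : 0 ≤ x) (h : phi x ≤ y) : x ≤ phiInv y := by
  have hy : 0 ≤ y := (bijOn_phi.mapsTo hx).trans h
  rwa [← strictMonoOn_phi.le_iff_le hx (phiInv_nonneg hy), phi_phiInv hy]

theorem phiInv_le {x y : ℝ} (hx : 0 ≤ x) (hy : 0 ≤ y) (h : y ≤ phi x) : phiInv y ≤ x := by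
  rwa [← strictMonoOn_phi.le_iff_le (phiInv_nonneg hy) hx, phi_phiInv hy]

theorem phiInv_eq_lambertW0 {y : ℝ} (hy : 0 ≤ y) : phiInv y = lambertW0 (y / Real.exp 1) := by
  have hmem : phiInv y ∈ Set.Ici (-1 : ℝ) := by
    have := phiInv_nonneg hy
    simp; linarith
  have hval : y / Real.exp 1 = (fun w : ℝ => w * Real.exp w) (phiInv y) := by
    have h := phi_phiInv hy
    rw [phi_eq] at h
    rw [div_eq_iff (Real.exp_pos 1).ne']
    simp only
    linarith
  rw [lambertW0, hval, strictMonoOn_mul_exp.injOn.leftInvOn_invFunOn hmem]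

theorem log_le_half {L : ℝ} (hL : 0 < L) : Real.log L ≤ L / 2 := by
  have h1 := Real.log_le_sub_one_of_pos (half_pos hL)
  rw [Real.log_div hL.ne' two_ne_zero] at h1
  have h2 := Real.log_le_sub_one_of_pos (zero_lt_two (α := ℝ))
  linarith

/-- With `L = log N`, the point `L - log L` already satisfies `φ (L - log L) ≥ N`, because
`φ (L - log L) = e (L - log L) N / L` and `log L ≤ L / 2`, `e ≥ 2`. -/
theorem phiInv_le_log_sub_log_log {N : ℕ} (hN : 2 ≤ N) :
    phiInv ((N : ℝ) - 1) ≤ Real.log N - Real.log (Real.log N) := by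
  have hN' : (2 : ℝ) ≤ N := by exact_mod_cast hN
  set L := Real.log N with hL
  have hLpos : 0 < L := Real.log_pos (by linarith)
  have hlog : Real.log L ≤ L / 2 := log_le_half hLpos
  refine phiInv_le (by linarith) (by linarith) ?_
  have hexp : Real.exp (L - Real.log L) = N / L := by
    rw [Real.exp_sub, Real.exp_log hLpos, hL, Real.exp_log (by linarith)]
  have he : (2 : ℝ) ≤ Real.exp 1 := by linarith [Real.add_one_le_exp (1 : ℝ)]
  rw [phi_eq, hexp]
  have h1 : L ≤ Real.exp 1 * (L - Real.log L) := by nlinarith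
  have h2 : (N : ℝ) ≤ Real.exp 1 * ((L - Real.log L) * (N / L)) := by
    rw [show Real.exp 1 * ((L - Real.log L) * (N / L)) = Real.exp 1 * (L - Real.log L) * N / L by
      ring, le_div_iff₀ hLpos]
    nlinarith
  linarith

theorem phiInv_isBigO_log_sub_log_log :
    (fun N : ℕ => phiInv ((N : ℝ) - 1)) =O[Filter.atTop]
      (fun N : ℕ => Real.log N - Real.log (Real.log N)) := by
  refine Asymptotics.IsBigO.of_bound 1 ?_
  filter_upwards [Filter.eventually_ge_atTop 2] with N hN
  have hN' : (2 : ℝ) ≤ N := by exact_mod_cast hN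
  have h := phiInv_le_log_sub_log_log hN
  have h0 : 0 ≤ phiInv ((N : ℝ) - 1) := phiInv_nonneg (by linarith)
  rw [Real.norm_of_nonneg h0, Real.norm_of_nonneg (h0.trans h), one_mul]
  exact h

theorem phiInv_isBigO_log :
    (fun N : ℕ => phiInv ((N : ℝ) - 1)) =O[Filter.atTop] (fun N : ℕ => Real.log N) := by
  refine Asymptotics.IsBigO.of_bound 1 ?_
  filter_upwards [Filter.eventually_ge_atTop 3] with N hN
  have hN' : (3 : ℝ) ≤ N := by exact_mod_cast hN
  have h := phiInv_le_log_sub_log_log (N := N) (by omega)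
  have h0 : 0 ≤ phiInv ((N : ℝ) - 1) := phiInv_nonneg (by linarith)
  have h1 : 1 ≤ Real.log N := by
    rw [Real.le_log_iff_exp_le (by linarith)]
    linarith [Real.exp_one_lt_d9]
  have h2 := Real.log_nonneg h1
  rw [Real.norm_of_nonneg h0, Real.norm_of_nonneg (by linarith), one_mul]
  linarith

theorem const_isBigO_log (c : ℝ) :
    (fun _ : ℕ => c) =O[Filter.atTop] (fun N : ℕ => Real.log N) := by
  refine (Asymptotics.isLittleO_const_left.2 (Or.inr ?_)).isBigO
  exact tendsto_norm_atTop_atTop.comp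
    (Real.tendsto_log_atTop.comp tendsto_natCast_atTop_atTop)

/-! ### Softmax averages -/

/-- The softmax weights `exp (-a j) / ∑ k, exp (-a k)` of a family `a` of energies. -/
noncomputable def gibbs {ι : Type*} [Fintype ι] (a : ι → ℝ) (j : ι) : ℝ :=
  Real.exp (-a j) / ∑ k, Real.exp (-a k)

section Gibbs

variable {ι : Type*} [Fintype ι]

theorem gibbs_nonneg (a : ι → ℝ) (j : ι) : 0 ≤ gibbs a j := by
  unfold gibbs; positivity

theorem sum_exp_pos [Nonempty ι] (a : ι → ℝ) : 0 < ∑ k, Real.exp (-a k) :=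
  Finset.sum_pos (fun _ _ => Real.exp_pos _) Finset.univ_nonempty

theorem sum_gibbs [Nonempty ι] (a : ι → ℝ) : ∑ j, gibbs a j = 1 := by
  unfold gibbs
  rw [← Finset.sum_div, div_self (sum_exp_pos a).ne']

/-- The mean energy `T` of a family of nonnegative energies, one of which vanishes, satisfies
`φ T ≤ N - 1`. Indeed `∑ j, (a j - T) exp (-a j) = 0`; isolating the vanishing energy gives
`T exp T = ∑ (a j - T) exp (-(a j - T))` over the `N - 1` other indices, and
`x exp (-x) ≤ exp (-1)`. -/
theorem sum_gibbs_mul_le_phiInv (a : ι → ℝ) (ha : ∀ j, 0 ≤ a j) {i : ι} (hi : a i = 0) :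
    ∑ j, gibbs a j * a j ≤ phiInv ((Fintype.card ι : ℝ) - 1) := by
  classical
  have : Nonempty ι := ⟨i⟩
  set T := ∑ j, gibbs a j * a j with hT
  have hT0 : 0 ≤ T := Finset.sum_nonneg fun j _ => mul_nonneg (gibbs_nonneg a j) (ha j)
  refine le_phiInv hT0 ?_
  have hS := sum_exp_pos a
  have hTS : T * ∑ k, Real.exp (-a k) = ∑ j, Real.exp (-a j) * a j := by
    rw [hT, Finset.sum_mul]
    refine Finset.sum_congr rfl fun j _ => ?_
    rw [gibbs]
    field_simp
  have hzero : ∑ j, (a j - T) * Real.exp (-a j) = 0 := by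
    simp only [sub_mul, Finset.sum_sub_distrib, ← Finset.mul_sum, hTS]
    rw [sub_eq_zero]
    exact Finset.sum_congr rfl fun j _ => mul_comm _ _
  rw [← Finset.add_sum_erase _ _ (Finset.mem_univ i), hi] at hzero
  have hterm : ∀ j ∈ Finset.univ.erase i,
      (a j - T) * Real.exp (-a j) ≤ Real.exp (-(T + 1)) := by
    intro j _
    have h := Real.add_one_le_exp (a j - T - 1)
    have h2 : Real.exp (-(T + 1)) = Real.exp (a j - T - 1) * Real.exp (-a j) := by
      rw [← Real.exp_add]; congr 1; ring
    rw [h2]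
    exact mul_le_mul_of_nonneg_right (by linarith) (Real.exp_pos _).le
  have hsum := Finset.sum_le_sum hterm
  rw [Finset.sum_const, Finset.card_erase_of_mem (Finset.mem_univ i), Finset.card_univ,
    nsmul_eq_mul, Nat.cast_sub Fintype.card_pos, Nat.cast_one] at hsum
  simp only [neg_zero, Real.exp_zero, mul_one] at hzero
  have hle : T ≤ ((Fintype.card ι : ℝ) - 1) * Real.exp (-(T + 1)) := by linarith
  rwa [Real.exp_neg, ← div_eq_mul_inv, le_div_iff₀ (Real.exp_pos _)] at hle

/-- The derivative of a softmax average splits into the average of the derivatives of the values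
and a covariance of the values with the derivatives of the energies. -/
theorem hasDerivAt_sum_gibbs_mul [Nonempty ι] {a c : ι → ℝ → ℝ} {a' c' : ι → ℝ} {t : ℝ}
    (ha : ∀ j, HasDerivAt (a j) (a' j) t) (hc : ∀ j, HasDerivAt (c j) (c' j) t) :
    HasDerivAt (fun r => ∑ j, gibbs (fun k => a k r) j * c j r)
      (∑ j, gibbs (fun k => a k t) j * c' j
        - ∑ j, gibbs (fun k => a k t) j
            * ((c j t - ∑ k, gibbs (fun l => a l t) k * c k t) * a' j)) t := by
  have hS := sum_exp_pos (fun k => a k t)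
  have hden : HasDerivAt (fun r => ∑ j, Real.exp (-a j r))
      (∑ j, Real.exp (-a j t) * -a' j) t :=
    HasDerivAt.fun_sum fun j _ => (ha j).neg.exp
  have hnum : HasDerivAt (fun r => ∑ j, Real.exp (-a j r) * c j r)
      (∑ j, (Real.exp (-a j t) * -a' j * c j t + Real.exp (-a j t) * c' j)) t :=
    HasDerivAt.fun_sum fun j _ => (ha j).neg.exp.mul (hc j)
  have h := hnum.div hden hS.ne'
  have hfun : (fun r => ∑ j, gibbs (fun k => a k r) j * c j r)
      = (fun r => ∑ j, Real.exp (-a j r) * c j r) / fun r => ∑ j, Real.exp (-a j r) := by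
    funext r
    simp only [gibbs, Pi.div_apply, Finset.sum_div]
    exact Finset.sum_congr rfl fun j _ => by ring
  rw [hfun]
  refine h.congr_deriv (Eq.symm ?_)
  have hmean : ∀ b : ι → ℝ, ∑ j, gibbs (fun k => a k t) j * b j
      = (∑ j, Real.exp (-a j t) * b j) / ∑ j, Real.exp (-a j t) := by
    intro b
    simp only [gibbs, Finset.sum_div]
    exact Finset.sum_congr rfl fun j _ => by ring
  simp only [hmean, sub_mul, mul_sub, Finset.sum_sub_distrib, Finset.sum_add_distrib]
  have e1 : ∑ j, Real.exp (-a j t) *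
      ((∑ k, Real.exp (-a k t) * c k t) / (∑ k, Real.exp (-a k t)) * a' j)
      = (∑ k, Real.exp (-a k t) * c k t) / (∑ k, Real.exp (-a k t))
        * ∑ j, Real.exp (-a j t) * a' j := by
    rw [Finset.mul_sum]; exact Finset.sum_congr rfl fun j _ => by ring
  have e2 : ∑ j, Real.exp (-a j t) * -a' j = -∑ j, Real.exp (-a j t) * a' j := by
    rw [← Finset.sum_neg_distrib]; exact Finset.sum_congr rfl fun j _ => by ring
  have e3 : ∑ j, Real.exp (-a j t) * -a' j * c j t
      = -∑ j, Real.exp (-a j t) * (c j t * a' j) := by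
    rw [← Finset.sum_neg_distrib]; exact Finset.sum_congr rfl fun j _ => by ring
  rw [e1, e2, e3]
  field_simp
  ring

end Gibbs

/-! ### The attention mean of a finite family of vectors -/

section AttnMean

variable {ι : Type*} [Fintype ι] {E : Type*} [NormedAddCommGroup E]

/-- The energies `‖y i - y j‖² / s` of the points `y j`, as seen from the query point `y i`. -/
noncomputable def sqDist (s : ℝ) (y : ι → E) (i j : ι) : ℝ := ‖y i - y j‖ ^ 2 / s

theorem sum_gibbs_mul_norm_sub_sq_le {s : ℝ} (hs : 0 < s) (y : ι → E) (i : ι) :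
    ∑ j, gibbs (sqDist s y i) j * ‖y i - y j‖ ^ 2
      ≤ s * phiInv ((Fintype.card ι : ℝ) - 1) := by
  have h := sum_gibbs_mul_le_phiInv (sqDist s y i) (fun j => by unfold sqDist; positivity)
    (i := i) (by simp [sqDist])
  refine le_of_eq_of_le ?_ (mul_le_mul_of_nonneg_left h hs.le)
  rw [Finset.mul_sum]
  refine Finset.sum_congr rfl fun j _ => ?_
  rw [sqDist]
  field_simp

variable [InnerProductSpace ℝ E]

/-- The mean of the points `y j` under the softmax weights that L2 attention with tied queries and
keys gives to the query point `y i`. -/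
noncomputable def attnMean (s : ℝ) (y : ι → E) (i : ι) : E :=
  ∑ j, gibbs (sqDist s y i) j • y j

/-- The mean minimizes the weighted sum of squared distances. -/
theorem sum_mul_norm_sub_mean_sq_le (p : ι → ℝ) (hp : ∑ j, p j = 1) (y : ι → E) (c : E) :
    ∑ j, p j * ‖y j - ∑ k, p k • y k‖ ^ 2 ≤ ∑ j, p j * ‖c - y j‖ ^ 2 := by
  set m := ∑ k, p k • y k with hm
  have hcross : ∑ j, p j * inner ℝ (c - m) (y j - m) = 0 := by
    have h : ∑ j, p j • (y j - m) = 0 := by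
      simp only [smul_sub, Finset.sum_sub_distrib, ← Finset.sum_smul, hp, one_smul, ← hm, sub_self]
    have h2 := congrArg (inner ℝ (c - m)) h
    simpa [inner_sum, inner_smul_right] using h2
  have hexp : ∀ j, p j * ‖c - y j‖ ^ 2
      = p j * ‖c - m‖ ^ 2 - 2 * (p j * inner ℝ (c - m) (y j - m)) + p j * ‖y j - m‖ ^ 2 := by
    intro j
    rw [show c - y j = (c - m) - (y j - m) by abel, norm_sub_sq_real]
    ring
  simp only [hexp, Finset.sum_add_distrib, Finset.sum_sub_distrib, ← Finset.mul_sum, hcross,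
    ← Finset.sum_mul, hp]
  nlinarith [sq_nonneg ‖c - m‖]

theorem sum_gibbs_mul_norm_sub_attnMean_sq_le {s : ℝ} (hs : 0 < s) (y : ι → E) (i : ι) :
    ∑ j, gibbs (sqDist s y i) j * ‖y j - attnMean s y i‖ ^ 2
      ≤ s * phiInv ((Fintype.card ι : ℝ) - 1) :=
  have : Nonempty ι := ⟨i⟩
  (sum_mul_norm_sub_mean_sq_le _ (sum_gibbs _) y (y i)).trans
    (sum_gibbs_mul_norm_sub_sq_le hs y i)

/-- The two factors are averaged by `2 x y ≤ x² + y²`; each square is bounded by the mean energy. -/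
theorem sum_gibbs_mul_norm_mul_norm_le {s : ℝ} (hs : 0 < s) (y : ι → E) (i : ι) :
    ∑ j, gibbs (sqDist s y i) j * (‖y j - attnMean s y i‖ * ‖y i - y j‖)
      ≤ s * phiInv ((Fintype.card ι : ℝ) - 1) := by
  have h1 := sum_gibbs_mul_norm_sub_sq_le hs y i
  have h2 := sum_gibbs_mul_norm_sub_attnMean_sq_le hs y i
  have h : ∑ j, gibbs (sqDist s y i) j * (‖y j - attnMean s y i‖ * ‖y i - y j‖)
      ≤ ∑ j, (gibbs (sqDist s y i) j * ‖y j - attnMean s y i‖ ^ 2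
        + gibbs (sqDist s y i) j * ‖y i - y j‖ ^ 2) / 2 := by
    refine Finset.sum_le_sum fun j _ => ?_
    have hg := gibbs_nonneg (sqDist s y i) j
    nlinarith [mul_nonneg hg (sq_nonneg (‖y j - attnMean s y i‖ - ‖y i - y j‖))]
  rw [← Finset.sum_div, Finset.sum_add_distrib] at h
  linarith

/-- The derivative of the attention mean along the line through `y` in the direction `u`, tested
against a vector `w`. -/
theorem hasDerivAt_inner_attnMean (s : ℝ) (y : ι → E) (i : ι) (u : ι → E) (w : E) (t : ℝ) :
    HasDerivAt (fun r : ℝ => inner ℝ w (attnMean s (fun k => y k + r • u k) i))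
      (∑ j, gibbs (sqDist s (fun k => y k + t • u k) i) j * inner ℝ w (u j)
        - ∑ j, gibbs (sqDist s (fun k => y k + t • u k) i) j
          * (inner ℝ w (y j + t • u j - attnMean s (fun k => y k + t • u k) i)
            * (2 * inner ℝ (y i + t • u i - (y j + t • u j)) (u i - u j) / s))) t := by
  have : Nonempty ι := ⟨i⟩
  have hy : ∀ k, HasDerivAt (fun r : ℝ => y k + r • u k) (u k) t := fun k => by
    simpa using ((hasDerivAt_id t).smul_const (u k)).const_add (y k)
  have ha : ∀ j, HasDerivAt (fun r : ℝ => sqDist s (fun k => y k + r • u k) i j)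
      (2 * inner ℝ (y i + t • u i - (y j + t • u j)) (u i - u j) / s) t := fun j =>
    ((hy i).sub (hy j)).norm_sq.div_const s
  have hc : ∀ j, HasDerivAt (fun r : ℝ => inner ℝ w (y j + r • u j)) (inner ℝ w (u j)) t :=
    fun j => by simpa using (hasDerivAt_const t w).inner ℝ (hy j)
  have h := hasDerivAt_sum_gibbs_mul ha hc
  have hmean : ∀ r : ℝ, inner ℝ w (attnMean s (fun k => y k + r • u k) i)
      = ∑ j, gibbs (sqDist s (fun k => y k + r • u k) i) j * inner ℝ w (y j + r • u j) := by
    intro r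
    simp only [attnMean, inner_sum, inner_smul_right]
  simp only [hmean, inner_sub_right]
  simpa only [inner_sub_right] using h

/-- The increment of the attention mean, tested against a vector `w`. The first term is the
average of the increments of the points; the second one bounds the covariance between the points
and the derivatives of the logits, by Cauchy–Schwarz and the bound on the mean energy. -/
theorem abs_inner_attnMean_sub_le {s : ℝ} (hs : 0 < s) (y : ι → E) (i : ι)
    (y' : ι → E) (w : E) {B₁ B₂ : ℝ}
    (h₁ : ∀ j, |inner ℝ w (y' j - y j)| ≤ B₁)
    (h₂ : ∀ j, ‖(y' i - y i) - (y' j - y j)‖ ≤ B₂) :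
    |inner ℝ w (attnMean s y' i - attnMean s y i)|
      ≤ B₁ + 2 * phiInv ((Fintype.card ι : ℝ) - 1) * ‖w‖ * B₂ := by
  have : Nonempty ι := ⟨i⟩
  set u : ι → E := fun k => y' k - y k with hu
  have hB₂ : 0 ≤ B₂ := (norm_nonneg _).trans (h₂ i)
  have key := norm_image_sub_le_of_norm_deriv_le_segment_01'
    (C := B₁ + 2 * phiInv ((Fintype.card ι : ℝ) - 1) * ‖w‖ * B₂)
    (fun t _ => (hasDerivAt_inner_attnMean s y i u w t).hasDerivWithinAt) ?_
  · rw [Real.norm_eq_abs, ← inner_sub_right] at key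
    simpa [hu] using key
  intro t _
  set z : ι → E := fun k => y k + t • u k with hz
  rw [Real.norm_eq_abs]
  have hg := gibbs_nonneg (sqDist s z i)
  have hfst : |∑ j, gibbs (sqDist s z i) j * inner ℝ w (u j)| ≤ B₁ := by
    refine (Finset.abs_sum_le_sum_abs _ _).trans ?_
    calc ∑ j, |gibbs (sqDist s z i) j * inner ℝ w (u j)|
        ≤ ∑ j, gibbs (sqDist s z i) j * B₁ := by
          refine Finset.sum_le_sum fun j _ => ?_
          rw [abs_mul, abs_of_nonneg (hg j)]
          exact mul_le_mul_of_nonneg_left (h₁ j) (hg j)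
      _ = B₁ := by rw [← Finset.sum_mul, sum_gibbs, one_mul]
  have hsnd : |∑ j, gibbs (sqDist s z i) j * (inner ℝ w (z j - attnMean s z i)
      * (2 * inner ℝ (z i - z j) (u i - u j) / s))|
      ≤ 2 * phiInv ((Fintype.card ι : ℝ) - 1) * ‖w‖ * B₂ := by
    refine (Finset.abs_sum_le_sum_abs _ _).trans ?_
    calc ∑ j, |gibbs (sqDist s z i) j * (inner ℝ w (z j - attnMean s z i)
          * (2 * inner ℝ (z i - z j) (u i - u j) / s))|
        ≤ ∑ j, 2 * ‖w‖ * B₂ / s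
            * (gibbs (sqDist s z i) j * (‖z j - attnMean s z i‖ * ‖z i - z j‖)) := by
          refine Finset.sum_le_sum fun j _ => ?_
          rw [abs_mul, abs_of_nonneg (hg j), abs_mul, abs_div, abs_mul, abs_of_pos hs, abs_two]
          have e1 := abs_real_inner_le_norm w (z j - attnMean s z i)
          have e2 : |inner ℝ (z i - z j) (u i - u j)| ≤ ‖z i - z j‖ * B₂ :=
            (abs_real_inner_le_norm _ _).trans
              (mul_le_mul_of_nonneg_left (h₂ j) (norm_nonneg _))
          calc gibbs (sqDist s z i) j * (|inner ℝ w (z j - attnMean s z i)|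
                * (2 * |inner ℝ (z i - z j) (u i - u j)| / s))
              ≤ gibbs (sqDist s z i) j * ((‖w‖ * ‖z j - attnMean s z i‖)
                * (2 * (‖z i - z j‖ * B₂) / s)) := by
                have := hg j
                gcongr
            _ = _ := by ring
      _ ≤ 2 * ‖w‖ * B₂ / s * (s * phiInv ((Fintype.card ι : ℝ) - 1)) := by
          rw [← Finset.mul_sum]
          exact mul_le_mul_of_nonneg_left (sum_gibbs_mul_norm_mul_norm_le hs z i) (by positivity)
      _ = _ := by field_simp
  exact (abs_sub _ _).trans (add_le_add hfst hsnd)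

theorem norm_attnMean_sub_le {s : ℝ} (hs : 0 < s) (y : ι → E) (i : ι)
    (y' : ι → E) {B₁ B₂ : ℝ}
    (h₁ : ∀ j, ‖y' j - y j‖ ≤ B₁) (h₂ : ∀ j, ‖(y' i - y i) - (y' j - y j)‖ ≤ B₂) :
    ‖attnMean s y' i - attnMean s y i‖
      ≤ B₁ + 2 * phiInv ((Fintype.card ι : ℝ) - 1) * B₂ := by
  -- Testing the increment against itself turns the scalar bound into a bound on the norm.
  set w := attnMean s y' i - attnMean s y i with hw
  have h := abs_inner_attnMean_sub_le hs y i y' w (B₁ := ‖w‖ * B₁)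
    (fun j => (abs_real_inner_le_norm _ _).trans
      (mul_le_mul_of_nonneg_left (h₁ j) (norm_nonneg _))) h₂
  rw [← hw, real_inner_self_eq_norm_mul_norm, abs_mul_self] at h
  rcases (norm_nonneg w).eq_or_lt with h0 | h0
  · have : Nonempty ι := ⟨i⟩
    have hφ : 0 ≤ phiInv ((Fintype.card ι : ℝ) - 1) :=
      phiInv_nonneg (sub_nonneg.2 (by exact_mod_cast Fintype.card_pos))
    have hB₁ := (norm_nonneg _).trans (h₁ i)
    have hB₂ := (norm_nonneg _).trans (h₂ i)
    rw [← h0]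
    positivity
  · nlinarith

end AttnMean

/-! ### Operator norms -/

theorem opNorm_nonneg (p : ℝ≥0∞) [Fact (1 ≤ p)] {m n : ℕ} (W : Matrix (Fin m) (Fin n) ℝ) :
    0 ≤ opNorm p W :=
  norm_nonneg _

theorem norm_toLp_mulVec_le (p : ℝ≥0∞) [Fact (1 ≤ p)] {m n : ℕ} (W : Matrix (Fin m) (Fin n) ℝ)
    (v : Fin n → ℝ) : ‖WithLp.toLp p (W.mulVec v)‖ ≤ opNorm p W * ‖WithLp.toLp p v‖ :=
  (LinearMap.toContinuousLinearMap (Matrix.toLpLin p p W)).le_opNorm (WithLp.toLp p v)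

theorem norm_mulVec_le {m n : ℕ} (W : Matrix (Fin m) (Fin n) ℝ) (v : Fin n → ℝ) :
    ‖W.mulVec v‖ ≤ opNorm ∞ W * ‖v‖ := by
  simpa only [PiLp.norm_toLp] using norm_toLp_mulVec_le ∞ W v

theorem inner_toLp_two {n : ℕ} (v w : Fin n → ℝ) :
    inner ℝ (WithLp.toLp 2 v) (WithLp.toLp 2 w) = v ⬝ᵥ w := by
  simp [EuclideanSpace.inner_toLp_toLp, dotProduct_comm]

theorem opNorm_two_transpose_le {m n : ℕ} (W : Matrix (Fin m) (Fin n) ℝ) :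
    opNorm 2 W.transpose ≤ opNorm 2 W := by
  refine ContinuousLinearMap.opNorm_le_bound _ (opNorm_nonneg 2 W) fun x => ?_
  obtain ⟨v, rfl⟩ : ∃ v, x = WithLp.toLp 2 v := ⟨x.ofLp, rfl⟩
  change ‖WithLp.toLp 2 (W.transpose.mulVec v)‖ ≤ opNorm 2 W * ‖WithLp.toLp 2 v‖
  set u := W.transpose.mulVec v with hu
  have h1 : ‖WithLp.toLp 2 u‖ ^ 2 ≤ ‖WithLp.toLp 2 v‖ * (opNorm 2 W * ‖WithLp.toLp 2 u‖) := by
    rw [← real_inner_self_eq_norm_sq, inner_toLp_two]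
    nth_rewrite 1 [hu]
    rw [Matrix.mulVec_transpose, ← Matrix.dotProduct_mulVec, ← inner_toLp_two]
    exact (real_inner_le_norm _ _).trans
      (mul_le_mul_of_nonneg_left (norm_toLp_mulVec_le 2 W u) (norm_nonneg _))
  rcases (norm_nonneg (WithLp.toLp 2 u)).eq_or_lt with h0 | h0
  · rw [← h0]
    exact mul_nonneg (opNorm_nonneg 2 W) (norm_nonneg _)
  · nlinarith

theorem norm_toLp_two_transpose_mulVec_le {m n : ℕ} (W : Matrix (Fin m) (Fin n) ℝ)
    (v : Fin m → ℝ) :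
    ‖WithLp.toLp 2 (W.transpose.mulVec v)‖ ≤ opNorm 2 W * ‖WithLp.toLp 2 v‖ :=
  (norm_toLp_mulVec_le 2 _ v).trans
    (mul_le_mul_of_nonneg_right (opNorm_two_transpose_le W) (norm_nonneg _))

theorem norm_toLp_two_le {d : ℕ} (v : Fin d → ℝ) : ‖WithLp.toLp 2 v‖ ≤ Real.sqrt d * ‖v‖ := by
  rw [EuclideanSpace.norm_eq]
  refine Real.sqrt_le_iff.2 ⟨by positivity, ?_⟩
  rw [mul_pow, Real.sq_sqrt d.cast_nonneg]
  calc ∑ i, ‖v i‖ ^ 2 ≤ ∑ _i : Fin d, ‖v‖ ^ 2 :=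
        Finset.sum_le_sum fun i _ => pow_le_pow_left₀ (norm_nonneg _) (norm_le_pi_norm v i) 2
    _ = d * ‖v‖ ^ 2 := by simp

theorem norm_sq_toLp_two {ι : Type*} [Fintype ι] (v : ι → ℝ) :
    ‖WithLp.toLp 2 v‖ ^ 2 = ∑ i, v i ^ 2 := by
  simp [EuclideanSpace.norm_sq_eq]

/-! ### A single head -/

/-- The rows of `X W`, as points of Euclidean space. -/
noncomputable def rowPoints {N D d : ℕ} (W : Matrix (Fin D) (Fin d) ℝ)
    (X : Matrix (Fin N) (Fin D) ℝ) (j : Fin N) : EuclideanSpace ℝ (Fin d) :=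
  WithLp.toLp 2 (W.transpose.mulVec (X j))

section Head

variable {N D H : ℕ} (W : Matrix (Fin D) (Fin (D / H)) ℝ) (X X' : Matrix (Fin N) (Fin D) ℝ)

theorem rowPoints_sub (j : Fin N) :
    rowPoints W X' j - rowPoints W X j = WithLp.toLp 2 (W.transpose.mulVec (X' j - X j)) := by
  rw [rowPoints, rowPoints, Matrix.mulVec_sub]; rfl

theorem attn_eq_gibbs (i j : Fin N) :
    attn H W W X i j = gibbs (sqDist (Real.sqrt ((D : ℝ) / H)) (rowPoints W X) i) j := by
  simp only [attn, softmax, logits, gibbs, sqDist, rowPoints, Matrix.of_apply,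
    Matrix.mulVec_transpose, WithLp.toLp_sub]

theorem attnMean_apply (i : Fin N) (c : Fin (D / H)) :
    attnMean (Real.sqrt ((D : ℝ) / H)) (rowPoints W X) i c
      = (attn H W W X * (X * W)) i c := by
  rw [Matrix.mul_apply, attnMean, WithLp.ofLp_sum, Finset.sum_apply]
  refine Finset.sum_congr rfl fun j _ => ?_
  rw [attn_eq_gibbs, PiLp.smul_apply, smul_eq_mul, rowPoints, Matrix.mulVec_transpose]
  rfl

/-- Row `i` of a head is `W m / √(D/H)`, where `m` is the attention mean of the rows of `X W`. -/
theorem head_row (i : Fin N) :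
    head H W X i = (Real.sqrt ((D : ℝ) / H))⁻¹ •
      W.mulVec (attnMean (Real.sqrt ((D : ℝ) / H)) (rowPoints W X) i).ofLp := by
  have h : head H W X
      = (Real.sqrt ((D : ℝ) / H))⁻¹ • (attn H W W X * (X * W) * W.transpose) := by
    rw [head, Matrix.mul_smul, Matrix.mul_assoc, Matrix.mul_assoc, Matrix.mul_assoc]
  have hm : (attnMean (Real.sqrt ((D : ℝ) / H)) (rowPoints W X) i).ofLp
      = (attn H W W X * (X * W)) i := funext (attnMean_apply W X i)
  rw [h, hm]
  change (Real.sqrt ((D : ℝ) / H))⁻¹ •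
    Matrix.vecMul ((attn H W W X * (X * W)) i) W.transpose = _
  rw [Matrix.vecMul_transpose]

theorem head_row_sub (i : Fin N) :
    head H W X' i - head H W X i = (Real.sqrt ((D : ℝ) / H))⁻¹ •
      W.mulVec (attnMean (Real.sqrt ((D : ℝ) / H)) (rowPoints W X') i
        - attnMean (Real.sqrt ((D : ℝ) / H)) (rowPoints W X) i).ofLp := by
  rw [head_row, head_row, ← smul_sub, ← Matrix.mulVec_sub]; rfl

theorem sqrt_div_pos (hD : 0 < D) (hHD : H ∣ D) : 0 < Real.sqrt ((D : ℝ) / H) :=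
  Real.sqrt_pos.2 (div_pos (by exact_mod_cast hD)
    (by exact_mod_cast Nat.pos_of_dvd_of_pos hHD hD))

/-- The sup-norm bound for one head. Each coordinate of the attention mean is its inner product
with a unit vector. Comparing the Euclidean with the sup norm on `ℝ^(D/H)` costs a factor
`√(D/H)`, which cancels the `1 / √(D/H)` of the head in the term with `φ⁻¹`. -/
theorem norm_head_row_sub_le (hD : 0 < D) (hHD : H ∣ D) (i : Fin N) {B : ℝ}
    (hB : ∀ j, ‖X' j - X j‖ ≤ B) :
    ‖head H W X' i - head H W X i‖
      ≤ (4 * phiInv ((N : ℝ) - 1) + 1 / Real.sqrt ((D : ℝ) / H))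
        * (opNorm ∞ W * opNorm ∞ W.transpose) * B := by
  have hs := sqrt_div_pos hD hHD
  have hd : Real.sqrt ((D / H : ℕ) : ℝ) = Real.sqrt ((D : ℝ) / H) := by
    rw [Nat.cast_div hHD (by exact_mod_cast (Nat.pos_of_dvd_of_pos hHD hD).ne')]
  rw [head_row_sub]
  set s := Real.sqrt ((D : ℝ) / H) with hs_def
  set C := opNorm ∞ W.transpose * B with hC
  have hcol : ∀ j, ‖W.transpose.mulVec (X' j - X j)‖ ≤ C := fun j =>
    (norm_mulVec_le _ _).trans (mul_le_mul_of_nonneg_left (hB j) (opNorm_nonneg _ _))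
  have hC0 : 0 ≤ C := (norm_nonneg _).trans (hcol i)
  have h₂ : ∀ j, ‖(rowPoints W X' i - rowPoints W X i)
      - (rowPoints W X' j - rowPoints W X j)‖ ≤ s * (2 * C) := by
    intro j
    rw [rowPoints_sub, rowPoints_sub, ← WithLp.toLp_sub]
    refine (norm_toLp_two_le _).trans ?_
    rw [hd]
    refine mul_le_mul_of_nonneg_left ((norm_sub_le _ _).trans ?_) hs.le
    linarith [hcol i, hcol j]
  have hφ : 0 ≤ phiInv ((N : ℝ) - 1) :=
    phiInv_nonneg (sub_nonneg.2 (by exact_mod_cast i.pos))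
  -- The coordinates of the increment are its inner products with the unit vectors `single a 1`.
  have hmean : ‖(attnMean s (rowPoints W X') i - attnMean s (rowPoints W X) i).ofLp‖
      ≤ C + 2 * phiInv ((N : ℝ) - 1) * 1 * (s * (2 * C)) := by
    refine (pi_norm_le_iff_of_nonneg (by positivity)).2 fun a => ?_
    have h := abs_inner_attnMean_sub_le hs (rowPoints W X) i (rowPoints W X')
      (EuclideanSpace.single a (1 : ℝ)) (B₁ := C) (fun j => ?_) h₂
    · simpa [EuclideanSpace.inner_single_left] using h
    · rw [rowPoints_sub, EuclideanSpace.inner_single_left]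
      simpa using (norm_le_pi_norm _ a).trans (hcol j)
  rw [norm_smul, norm_inv, Real.norm_of_nonneg hs.le]
  calc s⁻¹ * ‖W.mulVec (attnMean s (rowPoints W X') i - attnMean s (rowPoints W X) i).ofLp‖
      ≤ s⁻¹ * (opNorm ∞ W * (C + 2 * phiInv ((N : ℝ) - 1) * 1 * (s * (2 * C)))) := by
        gcongr
        exact (norm_mulVec_le _ _).trans (mul_le_mul_of_nonneg_left hmean (opNorm_nonneg _ _))
    _ = _ := by
        rw [hC]
        field_simp
        ring

/-- The Euclidean bound for one head, with `B` bounding the increment of every single row. -/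
theorem norm_toLp_two_head_row_sub_le (hD : 0 < D) (hHD : H ∣ D) (i : Fin N) {B : ℝ}
    (hB : ∀ j, ‖WithLp.toLp 2 (X' j - X j)‖ ≤ B) :
    ‖WithLp.toLp 2 (head H W X' i - head H W X i)‖
      ≤ (4 * phiInv ((N : ℝ) - 1) + 1) / Real.sqrt ((D : ℝ) / H) * opNorm 2 W ^ 2 * B := by
  have hs := sqrt_div_pos hD hHD
  rw [head_row_sub]
  set s := Real.sqrt ((D : ℝ) / H) with hs_def
  have h₁ : ∀ j, ‖rowPoints W X' j - rowPoints W X j‖ ≤ opNorm 2 W * B := fun j => by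
    rw [rowPoints_sub]
    exact (norm_toLp_two_transpose_mulVec_le _ _).trans
      (mul_le_mul_of_nonneg_left (hB j) (opNorm_nonneg _ _))
  have hmean := norm_attnMean_sub_le hs (rowPoints W X) i (rowPoints W X')
    (B₂ := 2 * (opNorm 2 W * B)) h₁
    (fun j => (norm_sub_le _ _).trans (by linarith [h₁ i, h₁ j]))
  rw [Fintype.card_fin] at hmean
  rw [WithLp.toLp_smul, norm_smul, norm_inv, Real.norm_of_nonneg hs.le]
  calc s⁻¹ * ‖WithLp.toLp 2
        (W.mulVec (attnMean s (rowPoints W X') i - attnMean s (rowPoints W X) i).ofLp)‖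
      ≤ s⁻¹ * (opNorm 2 W * (opNorm 2 W * B
          + 2 * phiInv ((N : ℝ) - 1) * (2 * (opNorm 2 W * B)))) := by
        gcongr
        exact (norm_toLp_mulVec_le 2 _ _).trans
          (mul_le_mul_of_nonneg_left hmean (opNorm_nonneg _ _))
    _ = _ := by
        field_simp
        ring

theorem trace_cov_le (hD : 0 < D) (hHD : H ∣ D) (i : Fin N) :
    (cov (attn H W W X i) ((((D : ℝ) / H) ^ (1 / 4 : ℝ))⁻¹ • (X * W))).trace
      ≤ phiInv ((N : ℝ) - 1) := by
  have hs := sqrt_div_pos hD hHD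
  have hc : (((D : ℝ) / H) ^ (1 / 4 : ℝ)) ^ 2 = Real.sqrt ((D : ℝ) / H) := by
    rw [← Real.rpow_natCast, ← Real.rpow_mul (by positivity), Real.sqrt_eq_rpow]
    norm_num
  set c := ((D : ℝ) / H) ^ (1 / 4 : ℝ)
  set s := Real.sqrt ((D : ℝ) / H)
  have h := sum_gibbs_mul_norm_sub_attnMean_sq_le hs (rowPoints W X) i
  rw [Fintype.card_fin] at h
  have hrow : ∀ j a, (X * W) j a = rowPoints W X j a := fun j a => by
    rw [rowPoints, Matrix.mulVec_transpose]
    rfl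
  have hmean : ∀ a, ∑ k, attn H W W X i k * (c⁻¹ * rowPoints W X k a)
      = c⁻¹ * attnMean s (rowPoints W X) i a := by
    intro a
    rw [attnMean_apply, Matrix.mul_apply, Finset.mul_sum]
    refine Finset.sum_congr rfl fun k _ => ?_
    rw [hrow]
    ring
  have htrace : (cov (attn H W W X i) (c⁻¹ • (X * W))).trace
      = s⁻¹ * ∑ j, gibbs (sqDist s (rowPoints W X) i) j
          * ‖rowPoints W X j - attnMean s (rowPoints W X) i‖ ^ 2 := by
    simp only [Matrix.trace, Matrix.diag_apply, cov, Matrix.of_apply,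
      Matrix.smul_apply, smul_eq_mul, hrow, hmean, EuclideanSpace.real_norm_sq_eq, PiLp.sub_apply]
    rw [Finset.sum_comm, Finset.mul_sum]
    refine Finset.sum_congr rfl fun j _ => ?_
    rw [Finset.mul_sum, Finset.mul_sum]
    refine Finset.sum_congr rfl fun a _ => ?_
    rw [attn_eq_gibbs, show s⁻¹ = c⁻¹ ^ 2 by rw [← hc, inv_pow]]
    ring
  rw [htrace, inv_mul_le_iff₀ hs]
  exact h

end Head

/-! ### All heads together -/

section MultiHead

variable {D H : ℕ} (hHD : H ∣ D) (WQ WV : Fin H → Matrix (Fin D) (Fin (D / H)) ℝ)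
  (WO : Matrix (Fin D) (Fin D) ℝ)

theorem mha_row_sub {N : ℕ} (X X' : Matrix (Fin N) (Fin D) ℝ) (i : Fin N) :
    mha hHD WQ WV WO N X' i - mha hHD WQ WV WO N X i
      = WO.transpose.mulVec fun c => ((WV (colEquiv hHD c).1).transpose.mulVec
          (head H (WQ (colEquiv hHD c).1) X' i - head H (WQ (colEquiv hHD c).1) X i))
            (colEquiv hHD c).2 := by
  rw [mha, mha, Matrix.mul_apply_eq_vecMul, Matrix.mul_apply_eq_vecMul, ← Matrix.sub_vecMul,
    Matrix.mulVec_transpose]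
  congr 1
  funext c
  simp only [concat, Pi.sub_apply, Matrix.of_apply, Matrix.mulVec_sub, Matrix.mulVec_transpose]
  rfl

theorem boundTop_nonneg {N : ℕ} (hN : 1 ≤ N) : 0 ≤ boundTop WQ WV WO N := by
  have hφ : 0 ≤ phiInv ((N : ℝ) - 1) := phiInv_nonneg (sub_nonneg.2 (by exact_mod_cast hN))
  have h1 : 0 ≤ ⨆ h, opNorm ∞ (WQ h) * opNorm ∞ (WQ h).transpose :=
    Real.iSup_nonneg fun h => mul_nonneg (opNorm_nonneg _ _) (opNorm_nonneg _ _)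
  have h2 : 0 ≤ ⨆ h, opNorm ∞ (WV h).transpose := Real.iSup_nonneg fun h => opNorm_nonneg _ _
  have h3 := opNorm_nonneg ∞ WO.transpose
  unfold boundTop
  positivity

theorem boundTwo_nonneg {N : ℕ} (hN : 1 ≤ N) : 0 ≤ boundTwo WQ WV WO N := by
  have hφ : 0 ≤ phiInv ((N : ℝ) - 1) := phiInv_nonneg (sub_nonneg.2 (by exact_mod_cast hN))
  have h3 := opNorm_nonneg 2 WO
  unfold boundTwo
  positivity

theorem lipschitzWith_flatten_top (hD : 0 < D) {N : ℕ} (hN : 1 ≤ N) :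
    LipschitzWith (boundTop WQ WV WO N).toNNReal (flatten ∞ (mha hHD WQ WV WO N)) := by
  refine LipschitzWith.of_dist_le_mul fun x' x => ?_
  rw [Real.coe_toNNReal _ (boundTop_nonneg WQ WV WO hN), dist_eq_norm, dist_eq_norm]
  set B := ‖x' - x‖ with hBdef
  set X : Matrix (Fin N) (Fin D) ℝ := Matrix.of fun i j => x (i, j) with hX
  set X' : Matrix (Fin N) (Fin D) ℝ := Matrix.of fun i j => x' (i, j) with hX'
  have hB : ∀ j, ‖X' j - X j‖ ≤ B := fun j =>
    (pi_norm_le_iff_of_nonneg (norm_nonneg _)).2 fun a => PiLp.norm_apply_le (x' - x) (j, a)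
  have hφ : 0 ≤ phiInv ((N : ℝ) - 1) := phiInv_nonneg (sub_nonneg.2 (by exact_mod_cast hN))
  have hnn := boundTop_nonneg WQ WV WO hN
  rw [← PiLp.norm_ofLp]
  refine (pi_norm_le_iff_of_nonneg (mul_nonneg hnn (norm_nonneg _))).2 fun ⟨i, b⟩ => ?_
  change ‖(mha hHD WQ WV WO N X' i - mha hHD WQ WV WO N X i) b‖ ≤ _
  refine (norm_le_pi_norm _ b).trans ?_
  rw [mha_row_sub]
  set K := 4 * phiInv ((N : ℝ) - 1) + 1 / Real.sqrt ((D : ℝ) / H) with hK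
  have hK0 : 0 ≤ K := by positivity
  have hB0 : 0 ≤ B := norm_nonneg _
  set MQ := ⨆ h, opNorm ∞ (WQ h) * opNorm ∞ (WQ h).transpose with hMQ
  set MV := ⨆ h, opNorm ∞ (WV h).transpose with hMV
  have hMQ0 : 0 ≤ MQ := Real.iSup_nonneg fun h => mul_nonneg (opNorm_nonneg _ _) (opNorm_nonneg _ _)
  have hMV0 : 0 ≤ MV := Real.iSup_nonneg fun h => opNorm_nonneg _ _
  have hblock : ‖fun c => ((WV (colEquiv hHD c).1).transpose.mulVec
      (head H (WQ (colEquiv hHD c).1) X' i - head H (WQ (colEquiv hHD c).1) X i))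
        (colEquiv hHD c).2‖ ≤ MV * (K * MQ * B) := by
    refine (pi_norm_le_iff_of_nonneg (by positivity)).2 fun c => ?_
    generalize colEquiv hHD c = ha
    obtain ⟨h, a⟩ := ha
    refine (norm_le_pi_norm _ a).trans ((norm_mulVec_le _ _).trans ?_)
    have hhead := norm_head_row_sub_le (WQ h) X X' hD hHD i hB
    have hq : opNorm ∞ (WQ h) * opNorm ∞ (WQ h).transpose ≤ MQ :=
      le_ciSup (f := fun h => opNorm ∞ (WQ h) * opNorm ∞ (WQ h).transpose)
        (Set.finite_range _).bddAbove h
    have hv : opNorm ∞ (WV h).transpose ≤ MV :=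
      le_ciSup (f := fun h => opNorm ∞ (WV h).transpose) (Set.finite_range _).bddAbove h
    refine mul_le_mul hv (hhead.trans ?_) (norm_nonneg _) hMV0
    gcongr
  calc _ ≤ opNorm ∞ WO.transpose * (MV * (K * MQ * B)) :=
        (norm_mulVec_le _ _).trans (mul_le_mul_of_nonneg_left hblock (opNorm_nonneg _ _))
    _ = boundTop WQ WV WO N * B := by
        rw [boundTop]
        ring

/-- Every row of the output is bounded separately by the norm of the whole increment; summing
the squares over the `N` rows produces the factor `√N`. -/
theorem lipschitzWith_flatten_two (hD : 0 < D) {N : ℕ} (hN : 1 ≤ N) :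
    LipschitzWith (boundTwo WQ WV WO N).toNNReal (flatten 2 (mha hHD WQ WV WO N)) := by
  refine LipschitzWith.of_dist_le_mul fun x' x => ?_
  have hnn := boundTwo_nonneg WQ WV WO hN
  rw [Real.coe_toNNReal _ hnn, dist_eq_norm, dist_eq_norm]
  set B := ‖x' - x‖ with hBdef
  have hB0 : 0 ≤ B := norm_nonneg _
  set X : Matrix (Fin N) (Fin D) ℝ := Matrix.of fun i j => x (i, j) with hX
  set X' : Matrix (Fin N) (Fin D) ℝ := Matrix.of fun i j => x' (i, j) with hX'
  have hB : ∀ j, ‖WithLp.toLp 2 (X' j - X j)‖ ≤ B := fun j => by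
    refine le_of_sq_le_sq ?_ hB0
    rw [norm_sq_toLp_two, hBdef, EuclideanSpace.real_norm_sq_eq, Fintype.sum_prod_type]
    exact Finset.single_le_sum (f := fun i => ∑ a, (x' - x) (i, a) ^ 2)
      (fun i _ => Finset.sum_nonneg fun a _ => sq_nonneg _) (Finset.mem_univ j)
  refine le_of_sq_le_sq ?_ (mul_nonneg hnn hB0)
  set K := (4 * phiInv ((N : ℝ) - 1) + 1) / Real.sqrt ((D : ℝ) / H) with hK
  have hblock : ∀ i h, ∑ a, ((WV h).transpose.mulVec
      (head H (WQ h) X' i - head H (WQ h) X i)) a ^ 2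
        ≤ (K * B) ^ 2 * (opNorm 2 (WQ h) ^ 4 * opNorm 2 (WV h) ^ 2) := by
    intro i h
    rw [← norm_sq_toLp_two]
    have h1 := (norm_toLp_two_transpose_mulVec_le (WV h) _).trans
      (mul_le_mul_of_nonneg_left (norm_toLp_two_head_row_sub_le (WQ h) X X' hD hHD i hB)
        (opNorm_nonneg 2 (WV h)))
    refine (pow_le_pow_left₀ (norm_nonneg _) h1 2).trans_eq ?_
    ring
  set S := ∑ h, opNorm 2 (WQ h) ^ 4 * opNorm 2 (WV h) ^ 2 with hS
  have hS0 : 0 ≤ S := by rw [hS]; positivity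
  have hrow : ∀ i, ∑ b, (mha hHD WQ WV WO N X' i - mha hHD WQ WV WO N X i) b ^ 2
      ≤ opNorm 2 WO ^ 2 * ((K * B) ^ 2 * S) := by
    intro i
    rw [mha_row_sub, ← norm_sq_toLp_two]
    refine (pow_le_pow_left₀ (norm_nonneg _) (norm_toLp_two_transpose_mulVec_le WO _) 2).trans ?_
    rw [mul_pow, norm_sq_toLp_two]
    refine mul_le_mul_of_nonneg_left ?_ (sq_nonneg _)
    rw [(colEquiv hHD).sum_comp fun ha => ((WV ha.1).transpose.mulVec
      (head H (WQ ha.1) X' i - head H (WQ ha.1) X i)) ha.2 ^ 2, Fintype.sum_prod_type, hS,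
      Finset.mul_sum]
    exact Finset.sum_le_sum fun h _ => hblock i h
  calc ‖flatten 2 (mha hHD WQ WV WO N) x' - flatten 2 (mha hHD WQ WV WO N) x‖ ^ 2
      = ∑ i, ∑ b, (mha hHD WQ WV WO N X' i - mha hHD WQ WV WO N X i) b ^ 2 := by
        rw [EuclideanSpace.real_norm_sq_eq, Fintype.sum_prod_type]
        rfl
    _ ≤ ∑ _i : Fin N, opNorm 2 WO ^ 2 * ((K * B) ^ 2 * S) := Finset.sum_le_sum fun i _ => hrow i
    _ = (boundTwo WQ WV WO N * B) ^ 2 := by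
        rw [boundTwo, ← hS, Finset.sum_const, Finset.card_univ, Fintype.card_fin, nsmul_eq_mul, hK]
        simp only [mul_pow, div_pow, Real.sq_sqrt hS0, Real.sq_sqrt N.cast_nonneg]
        ring

theorem lipConst_le {α β : Type*} [PseudoMetricSpace α] [PseudoMetricSpace β] {f : α → β}
    {K : ℝ} (hK : 0 ≤ K) (h : LipschitzWith K.toNNReal f) : (lipConst f : ℝ) ≤ K := by
  rw [← Real.coe_toNNReal K hK, NNReal.coe_le_coe]
  exact csInf_le (OrderBot.bddBelow _) h

theorem boundTop_isBigO :
    (fun N : ℕ => boundTop WQ WV WO N) =O[Filter.atTop] (fun N : ℕ => Real.log N) := by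
  have h := (phiInv_isBigO_log.const_mul_left 4).add
    (const_isBigO_log (1 / Real.sqrt ((D : ℝ) / H)))
  refine (h.const_mul_left (opNorm ∞ WO.transpose
    * (⨆ h, opNorm ∞ (WQ h) * opNorm ∞ (WQ h).transpose)
    * (⨆ h, opNorm ∞ (WV h).transpose))).congr_left fun N => ?_
  rw [boundTop]
  ring

theorem boundTwo_isBigO :
    (fun N : ℕ => boundTwo WQ WV WO N) =O[Filter.atTop]
      (fun N : ℕ => Real.sqrt N * Real.log N) := by
  have h := (Asymptotics.isBigO_refl (fun N : ℕ => Real.sqrt N) Filter.atTop).mul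
    ((phiInv_isBigO_log.const_mul_left 4).add (const_isBigO_log 1))
  refine (h.const_mul_left ((Real.sqrt ((D : ℝ) / H))⁻¹
    * Real.sqrt (∑ h, opNorm 2 (WQ h) ^ 4 * opNorm 2 (WV h) ^ 2)
    * opNorm 2 WO)).congr_left fun N => ?_
  rw [boundTwo]
  ring

end MultiHead

end L2Attention

theorem theorem3p2 :
    -- `φ` is invertible on the nonnegative reals
    Set.BijOn L2Attention.phi (Set.Ici 0) (Set.Ici 0) ∧
    -- its inverse through the Lambert function, and the growth of that inverse
    (∀ N : ℕ, 1 ≤ N →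
      L2Attention.phiInv ((N : ℝ) - 1) = L2Attention.lambertW0 (((N : ℝ) - 1) / Real.exp 1)) ∧
    (fun N : ℕ => L2Attention.phiInv ((N : ℝ) - 1)) =O[Filter.atTop]
      (fun N : ℕ => Real.log N - Real.log (Real.log N)) ∧
    ∀ (D H : ℕ) (_ : 0 < D) (hHD : H ∣ D)
      (WQ WV : Fin H → Matrix (Fin D) (Fin (D / H)) ℝ) (WO : Matrix (Fin D) (Fin D) ℝ),
      (∀ N : ℕ, 1 ≤ N →
        -- Lipschitz continuity and the bound for `p = ∞`
        ((∃ K : ℝ≥0, LipschitzWith K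
            (L2Attention.flatten ∞ (L2Attention.mha hHD WQ WV WO N))) ∧
          (L2Attention.lipConst (L2Attention.flatten ∞ (L2Attention.mha hHD WQ WV WO N)) : ℝ)
            ≤ L2Attention.boundTop WQ WV WO N) ∧
        -- Lipschitz continuity and the bound for `p = 2`
        ((∃ K : ℝ≥0, LipschitzWith K
            (L2Attention.flatten 2 (L2Attention.mha hHD WQ WV WO N))) ∧
          (L2Attention.lipConst (L2Attention.flatten 2 (L2Attention.mha hHD WQ WV WO N)) : ℝ)
            ≤ L2Attention.boundTwo WQ WV WO N) ∧
        -- the trace of the softmax-weighted covariance of the rows of `X W^Q / (D/H)^{1/4}`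
        (∀ (h : Fin H) (X : Matrix (Fin N) (Fin D) ℝ) (i : Fin N),
          (L2Attention.cov (L2Attention.attn H (WQ h) (WQ h) X i)
            ((((D : ℝ) / H) ^ (1 / 4 : ℝ))⁻¹ • (X * WQ h))).trace
            ≤ L2Attention.phiInv ((N : ℝ) - 1))) ∧
      -- growth of the two bounds in the sequence length, for fixed weights
      (fun N : ℕ => L2Attention.boundTop WQ WV WO N) =O[Filter.atTop]
        (fun N : ℕ => Real.log N) ∧
      (fun N : ℕ => L2Attention.boundTwo WQ WV WO N) =O[Filter.atTop]
        (fun N : ℕ => Real.sqrt N * Real.log N) := by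
  refine ⟨L2Attention.bijOn_phi, fun N hN => ?_, L2Attention.phiInv_isBigO_log_sub_log_log,
    fun D H hD hHD WQ WV WO => ⟨fun N hN => ⟨?_, ?_, fun h X i => ?_⟩, ?_, ?_⟩⟩
  · exact L2Attention.phiInv_eq_lambertW0 (sub_nonneg.2 (by exact_mod_cast hN))
  · have h := L2Attention.lipschitzWith_flatten_top hHD WQ WV WO hD hN
    exact ⟨⟨_, h⟩, L2Attention.lipConst_le (L2Attention.boundTop_nonneg WQ WV WO hN) h⟩
  · have h := L2Attention.lipschitzWith_flatten_two hHD WQ WV WO hD hN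
    exact ⟨⟨_, h⟩, L2Attention.lipConst_le (L2Attention.boundTwo_nonneg WQ WV WO hN) h⟩
  · exact L2Attention.trace_cov_le (WQ h) X hD hHD i
  · exact L2Attention.boundTop_isBigO WQ WV WO
  · exact L2Attention.boundTwo_isBigO WQ WV WO
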